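/- \textbf{Theorem.} Let $X$ be any topological space, let $\mathfrak{Off}(X)$ be the poset of its open subsets, and let $\mathsf{Grp}$ be the category (and 2-category) of small groupoids. Let $\Pi_1:\mathfrak{Off}(X)\to\mathsf{Grp}$ be the functor sending $U$ to its fundamental groupoid $\Pi_1(U)$ (objects: points of $U$; morphisms: homotopy classes of paths in $U$ relative to endpoints). Then $\Pi_1$ is simultaneously a cosheaf and a costack of groupoids. That is, for every open set $U\subseteq X$ and every open cover $U=\bigcup_{i\in I}U_i$ by a (small) family of open sets: (1) (Cosheaf) The functor $\coprod_i \Pi_1(U_i)\to\Pi_1(U)$ induced by the inclusions $U_i\subseteq U$ is the coequaliser, in the category of groupoids, of the two functors $$b_0,b_1:\coprod_{i,j}\Pi_1(U_i\cap U_j)\rightrightarrows\coprod_i\Pi_1(U_i)$$ induced by the inclusions $U_i\cap U_j\subseteq U_i$ and $U_i\cap U_j\subseteq U_j$ respectively. (2) (Costack) $\Pi_1(U)$, with the functors induced by the inclusions into $U$, is the 2-colimit of the diagram $\mathcal D$ $$\coprod_{i,j,k}\Pi_1(U_i\cap U_j\cap U_k)\;\substack{\to\\ \to\\ \to}\;\coprod_{i,j}\Pi_1(U_i\cap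 U_j)\rightrightarrows\coprod_i\Pi_1(U_i)$$ of groupoids and face functors (each induced by omitting one index). Here, for a functor $\mathcal D:J\to\mathsf{Grp}$ and a groupoid $S$, a pseudo-cocone with vertex $S$ consists of functors $\alpha_j:\mathcal D_j\to S$ and natural isomorphisms $\lambda_f:\alpha_j\circ\mathcal D(f)\Rightarrow\alpha_i$ for $f:i\to j$ in $J$, with $\lambda_{\mathrm{id}}=\mathrm{id}$ and $\lambda_{g f}=\lambda_f\circ(\lambda_g\star\mathcal D(f))$; morphisms are families of natural transformations $\alpha_j\Rightarrow\alpha'_j$ compatible with the $\lambda_f,\lambda'_f$. A pseudo-cocone $(\alpha_j,\lambda_f)$ with vertex $T$ is a 2-colimit of $\mathcal D$ if for every small groupoid $S$ the functor $\chi\mapsto(\chi\circ\alpha_j,\chi\star\lambda_f)$, from the groupoid of functors $T\to S$ to the groupoid of pseudo-cocones with vertex $S$, is an equivalence. In (2) the isomorphisms $\lambda_f$ on $\Pi_1(U)$ are identities. -/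

import Mathlib

open CategoryTheory TopologicalSpace

universe w w' u v

namespace VanKampen

/-! ### Disjoint unions (coproducts) of groupoids -/

/-- The disjoint union of a family of groupoids is a groupoid. -/
instance sigmaGroupoid {ι : Type w} (C : ι → Type u) [∀ i, Groupoid.{v} (C i)] :
    Groupoid (Σ i, C i) where
  inv {_ _} f := match f with
    | .mk g => .mk (Groupoid.inv g)
  inv_comp := by
    rintro _ _ ⟨g⟩
    exact congrArg Sigma.SigmaHom.mk (Groupoid.inv_comp g)
  comp_inv := by
    rintro _ _ ⟨g⟩
    exact congrArg Sigma.SigmaHom.mk (Groupoid.comp_inv g)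

/-- The coproduct `∐ᵢ C i` of a small family of small groupoids, as an object of `Grpd`:
the disjoint union. -/
def coprod {ι : Type u} (C : ι → Grpd.{u, u}) : Grpd.{u, u} :=
  Grpd.of (Σ i, C i)

/-- The morphism `∐ᵢ C i ⟶ D` with components `F i : C i ⟶ D`. -/
def coprodDesc {ι : Type u} {C : ι → Grpd.{u, u}} {D : Grpd.{u, u}} (F : ∀ i, C i ⟶ D) :
    coprod C ⟶ D :=
  Sigma.desc (C := fun i => (C i : Type u)) (D := (D : Type u)) F

/-- The `i`-th inclusion `C i ⟶ ∐ᵢ C i`. -/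
def coprodIncl {ι : Type u} (C : ι → Grpd.{u, u}) (i : ι) : C i ⟶ coprod C :=
  Sigma.incl (C := fun i => (C i : Type u)) i

theorem coprodIncl_desc {ι : Type u} {C : ι → Grpd.{u, u}} {D : Grpd.{u, u}}
    (F : ∀ i, C i ⟶ D) (i : ι) : coprodIncl C i ≫ coprodDesc F = F i := rfl

theorem coprod_hom_ext {ι : Type u} {C : ι → Grpd.{u, u}} {D : Grpd.{u, u}}
    {F G : coprod C ⟶ D} (h : ∀ i, coprodIncl C i ≫ F = coprodIncl C i ≫ G) : F = G := by
  have hobj : ∀ x : coprod C, F.obj x = G.obj x := by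
    rintro ⟨i, x⟩
    exact Functor.congr_obj (h i) x
  refine CategoryTheory.Functor.ext hobj ?_
  rintro _ _ ⟨f⟩
  exact Functor.congr_hom (h _) f

/-! ### Cosheaves of groupoids -/

section Cosheaf

variable {X : Type u} [TopologicalSpace X] (G : Opens X ⥤ Grpd.{u, u}) {ι : Type u}
  (U : ι → Opens X)

/-- The map `b₀ : ∐_{i,j} G(Uᵢ ∩ Uⱼ) ⟶ ∐ᵢ G(Uᵢ)` induced by the inclusions `Uᵢ ∩ Uⱼ ⊆ Uᵢ`. -/
def b₀ : coprod (fun p : ι × ι => G.obj (U p.1 ⊓ U p.2)) ⟶ coprod (fun i => G.obj (U i)) :=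
  coprodDesc fun p => G.map (homOfLE inf_le_left) ≫ coprodIncl (fun i => G.obj (U i)) p.1

/-- The map `b₁ : ∐_{i,j} G(Uᵢ ∩ Uⱼ) ⟶ ∐ᵢ G(Uᵢ)` induced by the inclusions `Uᵢ ∩ Uⱼ ⊆ Uⱼ`. -/
def b₁ : coprod (fun p : ι × ι => G.obj (U p.1 ⊓ U p.2)) ⟶ coprod (fun i => G.obj (U i)) :=
  coprodDesc fun p => G.map (homOfLE inf_le_right) ≫ coprodIncl (fun i => G.obj (U i)) p.2

/-- The map `a : ∐ᵢ G(Uᵢ) ⟶ G(V)` induced by inclusions `Uᵢ ⊆ V`. -/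
def augmentation {V : Opens X} (h : ∀ i, U i ≤ V) : coprod (fun i => G.obj (U i)) ⟶ G.obj V :=
  coprodDesc fun i => G.map (homOfLE (h i))

theorem b₀_augmentation {V : Opens X} (h : ∀ i, U i ≤ V) :
    b₀ G U ≫ augmentation G U h = b₁ G U ≫ augmentation G U h := by
  apply coprod_hom_ext
  intro p
  change G.map (homOfLE inf_le_left) ≫ G.map (homOfLE (h p.1)) =
    G.map (homOfLE inf_le_right) ≫ G.map (homOfLE (h p.2))
  rw [← G.map_comp, ← G.map_comp]
  rfl

/-- `G` is a cosheaf of groupoids: for every open cover `V = ⋃ᵢ Uᵢ`, the map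
`∐ᵢ G(Uᵢ) ⟶ G(V)` is the coequaliser of `b₀` and `b₁` in the category of groupoids. -/
def IsCosheaf {X : Type u} [TopologicalSpace X] (G : Opens X ⥤ Grpd.{u, u}) : Prop :=
  ∀ (V : Opens X) (ι : Type u) (U : ι → Opens X) (hU : ⨆ i, U i = V),
    Nonempty (Limits.IsColimit
      (Limits.Cofork.ofπ (augmentation G U fun i => (le_iSup U i).trans hU.le)
        (b₀_augmentation G U _)))

end Cosheaf

/-! ### 2-colimits of groupoids -/

section TwoColimit

variable {J : Type w} [Category.{w'} J]

/-- A pseudo-cocone under `D : J ⥤ Grpd` with vertex the groupoid `S`: functors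
`αᵢ : D i ⥤ S` and natural isomorphisms `λ_f : α_j ∘ D f ⟹ αᵢ` for `f : i ⟶ j`, satisfying the
unit and `1`-cocycle conditions (as `D` is a strict functor, the `eqToHom`s only identify
equal objects). -/
structure PseudoCocone (D : J ⥤ Grpd.{v, u}) (S : Grpd.{v, u}) where
  leg (j : J) : D.obj j ⥤ S
  iso {i j : J} (f : i ⟶ j) : Functor.comp (D.map f) (leg j) ≅ leg i
  iso_id (i : J) (x : D.obj i) :
    (iso (𝟙 i)).hom.app x = eqToHom (by simp only [D.map_id]; rfl)
  iso_comp {i j k : J} (f : i ⟶ j) (g : j ⟶ k) (x : D.obj i) :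
    (iso (f ≫ g)).hom.app x =
      eqToHom (by simp only [D.map_comp]; rfl) ≫
        (iso g).hom.app ((D.map f).obj x) ≫ (iso f).hom.app x

namespace PseudoCocone

/-- A morphism of pseudo-cocones with the same vertex: natural transformations
`αᵢ ⟹ βᵢ` compatible with the structure isomorphisms. -/
@[ext]
structure Hom {D : J ⥤ Grpd.{v, u}} {S : Grpd.{v, u}} (c c' : PseudoCocone D S) where
  app (j : J) : c.leg j ⟶ c'.leg j
  comm {i j : J} (f : i ⟶ j) (x : D.obj i) :
    (c.iso f).hom.app x ≫ (app i).app x = (app j).app ((D.map f).obj x) ≫ (c'.iso f).hom.app x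

/-- The category of pseudo-cocones under `D` with vertex `S`, that is, the 2-limit of the
groupoids of functors `D j ⥤ S`. -/
instance category (D : J ⥤ Grpd.{v, u}) (S : Grpd.{v, u}) : Category (PseudoCocone D S) where
  Hom := Hom
  id c := { app := fun j => 𝟙 (c.leg j), comm := by intros; simp }
  comp φ ψ :=
    { app := fun j => φ.app j ≫ ψ.app j
      comm := by
        intro i j f x
        rw [NatTrans.comp_app, NatTrans.comp_app, ← Category.assoc, φ.comm, Category.assoc,
          ψ.comm, Category.assoc] }
  id_comp _ := Hom.ext (funext fun _ => Category.id_comp _)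
  comp_id _ := Hom.ext (funext fun _ => Category.comp_id _)
  assoc _ _ _ := Hom.ext (funext fun _ => Category.assoc _ _ _)

variable {D : J ⥤ Grpd.{v, u}} {T : Grpd.{v, u}}

/-- The pseudo-cocone `(χ ∘ αⱼ, χ ⋆ λ_f)` obtained from `c = (αⱼ, λ_f)` and `χ : T ⥤ S`. -/
def postcomp (c : PseudoCocone D T) {S : Grpd.{v, u}} (χ : T ⥤ S) : PseudoCocone D S where
  leg j := c.leg j ⋙ χ
  iso f := Functor.isoWhiskerRight (c.iso f) χ
  iso_id i x := by
    change χ.map ((c.iso (𝟙 i)).hom.app x) = _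
    rw [c.iso_id, eqToHom_map]
  iso_comp f g x := by
    change χ.map ((c.iso (f ≫ g)).hom.app x) = _
    rw [c.iso_comp, χ.map_comp, χ.map_comp, eqToHom_map]
    rfl

/-- The canonical functor `κ : Hom(T, S) ⥤ 2-lim Hom(D j, S)`. -/
def kappa (c : PseudoCocone D T) (S : Grpd.{v, u}) : (T ⥤ S) ⥤ PseudoCocone D S where
  obj χ := c.postcomp χ
  map τ :=
    { app := fun j => Functor.whiskerLeft (c.leg j) τ
      comm := fun f x => τ.naturality ((c.iso f).hom.app x) }
  map_id _ := rfl
  map_comp _ _ := rfl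

/-- A pseudo-cocone exhibits its vertex `T` as the 2-colimit of `D` if, for every groupoid `S`,
the canonical functor `Hom(T, S) ⥤ 2-lim Hom(D j, S)` is an equivalence. -/
def IsTwoColimit (c : PseudoCocone D T) : Prop :=
  ∀ S : Grpd.{v, u}, (c.kappa S).IsEquivalence

/-- A strict cocone, regarded as a pseudo-cocone with identity structure isomorphisms. -/
def ofCocone (c : Limits.Cocone D) : PseudoCocone D c.pt where
  leg j := c.ι.app j
  iso f := eqToIso (c.w f)
  iso_id i x := by
    rw [eqToIso.hom]
    exact eqToHom_app _ x
  iso_comp f g x := by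
    simp only [eqToIso.hom]
    erw [eqToHom_app, eqToHom_app, eqToHom_app]
    simp

end PseudoCocone

end TwoColimit

/-! ### Costacks of groupoids -/

/-- The shape of the truncated Čech diagram: three objects `[0]`, `[1]`, `[2]`, with exactly the
face maps between them (and their composites), going from higher to lower degree. -/
structure CechShape : Type where
  deg : Fin 3

/-- A morphism `[m] ⟶ [n]` is a strictly increasing map `{0, …, n} → {0, …, m}`. -/
instance : SmallCategory CechShape where
  Hom m n := Fin (n.deg.val + 1) ↪o Fin (m.deg.val + 1)
  id m := RelEmbedding.refl _
  comp f g := RelEmbedding.trans g f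

/-- The map of finite ordinals underlying a morphism of `CechShape`. -/
def CechShape.toFun {m n : CechShape} (f : m ⟶ n) : Fin (n.deg.val + 1) → Fin (m.deg.val + 1) :=
  fun k => RelEmbedding.toEmbedding f k

section Cech

variable {X : Type u} [TopologicalSpace X] {ι : Type u} (U : ι → Opens X)

/-- The open set `⋂ₖ U (σ k)` for a finite sequence `σ` of indices. -/
def cechOpen {n : ℕ} (σ : Fin n → ι) : Opens X :=
  ⟨⋂ k, (U (σ k) : Set X), isOpen_iInter_of_finite fun k => (U (σ k)).isOpen⟩

theorem cechOpen_le {m n : ℕ} (σ : Fin m → ι) (f : Fin n → Fin m) :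
    cechOpen U σ ≤ cechOpen U (σ ∘ f) :=
  fun _ hx => Set.mem_iInter.2 fun k => Set.mem_iInter.1 hx (f k)

theorem cechOpen_le_of_le {V : Opens X} (h : ∀ i, U i ≤ V) {n : ℕ} (σ : Fin (n + 1) → ι) :
    cechOpen U σ ≤ V :=
  fun _ hx => h (σ 0) (Set.mem_iInter.1 hx 0)

variable (G : Opens X ⥤ Grpd.{u, u})

/-- The Čech diagram
`∐_{i,j,k} G(Uᵢ ∩ Uⱼ ∩ U_k) ⇛ ∐_{i,j} G(Uᵢ ∩ Uⱼ) ⇉ ∐ᵢ G(Uᵢ)`. The face map attached to `f`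
sends the summand indexed by `σ` to the summand indexed by `σ ∘ f`. -/
def cechDiagram : CechShape ⥤ Grpd.{u, u} where
  obj m := coprod fun σ : Fin (m.deg.val + 1) → ι => G.obj (cechOpen U σ)
  map {m n} f := coprodDesc fun σ =>
    G.map (homOfLE (cechOpen_le U σ (CechShape.toFun f))) ≫
      coprodIncl (fun τ : Fin (n.deg.val + 1) → ι => G.obj (cechOpen U τ)) (σ ∘ CechShape.toFun f)
  map_id m := by
    apply coprod_hom_ext
    intro σ
    change G.map (𝟙 (cechOpen U σ)) ≫
      coprodIncl (fun σ : Fin (m.deg.val + 1) → ι => G.obj (cechOpen U σ)) σ = _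
    rw [G.map_id]
    rfl
  map_comp {m n k} f g := by
    apply coprod_hom_ext
    intro σ
    change G.map (homOfLE (cechOpen_le U σ (CechShape.toFun f)) ≫
        homOfLE (cechOpen_le U (σ ∘ CechShape.toFun f) (CechShape.toFun g))) ≫
      coprodIncl (fun τ : Fin (k.deg.val + 1) → ι => G.obj (cechOpen U τ))
        ((σ ∘ CechShape.toFun f) ∘ CechShape.toFun g) = _
    rw [G.map_comp]
    rfl

/-- The cocone from the Čech diagram to `G(V)`, induced by the inclusions of the finite
intersections into `V`. -/
def cechCocone {V : Opens X} (h : ∀ i, U i ≤ V) : Limits.Cocone (cechDiagram U G) where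
  pt := G.obj V
  ι :=
    { app := fun m => coprodDesc fun σ => G.map (homOfLE (cechOpen_le_of_le U h σ))
      naturality := by
        intro m n f
        apply coprod_hom_ext
        intro σ
        exact (G.map_comp (homOfLE (cechOpen_le U σ (CechShape.toFun f)))
          (homOfLE (cechOpen_le_of_le U h (σ ∘ CechShape.toFun f)))).symm }

end Cech

/-- `G` is a costack of groupoids: for every open cover `V = ⋃ᵢ Uᵢ`, the canonical maps exhibit
`G(V)` as the 2-colimit of the Čech diagram. -/
def IsCostack {X : Type u} [TopologicalSpace X] (G : Opens X ⥤ Grpd.{u, u}) : Prop :=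
  ∀ (V : Opens X) (ι : Type u) (U : ι → Opens X) (hU : ⨆ i, U i = V),
    (PseudoCocone.ofCocone
      (cechCocone U G fun i => (le_iSup U i).trans hU.le)).IsTwoColimit

/-! ### The fundamental groupoid of open subsets -/

/-- The functor `U ↦ Π₁(U)` on the poset of open subsets of `X`, with values in groupoids. -/
noncomputable def fundamentalGroupoid (X : Type u) [TopologicalSpace X] : Opens X ⥤ Grpd.{u, u} :=
  Opens.toTopCat (TopCat.of X) ⋙ FundamentalGroupoid.fundamentalGroupoidFunctor

end VanKampen

namespace VanKampen

open Set unitInterval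

/-! ### Paths with values in a subset, and paths along segments -/

/-! Both claims say that functors out of `Π₁(V)` are glued, in one way, from functors on the
`Π₁(Uᵢ)`.

A descent datum yields a `LocalTransport`: an object of `S` over each point and a morphism along
each path inside a member. Extending it to all paths is like parallel transport in a flat bundle.
Over a convex set `A` mapped to the space by `f`, a parallel family `s p : a ⟶ L.obj (f p)` is
determined by one value, since `A` is connected (`IsParallel.eq_of_eq`), and exists over the unit
square with any prescribed value, by gluing over a fine grid (`hasSections_unitSquare`). Transport
along a path is the value at `1` of the family starting at the identity. By
`IsParallel.comp_transport` it computes every parallel family along segments, which gives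
functoriality and homotopy invariance without comparing subdivisions.

Uniqueness holds because paths inside members generate all path classes
(`homotopicQuotient_induction`). For the cosheaf property the gluing morphisms are `eqToHom`s, so
the glued functor restricts strictly to the given ones. For the costack property they come from the
double intersections, and the triple intersections give the cocycle condition. -/

/-- A path all of whose values lie in `A`, as a path in the subspace `A`. -/
def restrictPath {Y : Type*} [TopologicalSpace Y] {A : Set Y} {x y : Y} (γ : Path x y)
    (h : ∀ t, γ t ∈ A) :
    Path (⟨x, by simpa using h 0⟩ : A) ⟨y, by simpa using h 1⟩ where
  toFun t := ⟨γ t, h t⟩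
  continuous_toFun := by fun_prop
  source' := by simp
  target' := by simp

section Segment

variable {E : Type*} [NormedAddCommGroup E] [NormedSpace ℝ E] {Y : Type*} [TopologicalSpace Y]

/-- The image under `f` of the straight path from `q` to `r`. -/
def segPath (f : C(E, Y)) (q r : E) : Path (f q) (f r) := (Path.segment q r).map f.continuous

theorem pathSegment_mem {A : Set E} (hA : Convex ℝ A) {q r : E} (hq : q ∈ A) (hr : r ∈ A) (t : I) :
    Path.segment q r t ∈ A :=
  hA.segment_subset hq hr (by rw [← Path.range_segment]; exact mem_range_self t)

theorem segPath_mem {f : C(E, Y)} {A : Set E} {B : Set Y} (hA : Convex ℝ A) (hAB : MapsTo f A B)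
    {q r : E} (hq : q ∈ A) (hr : r ∈ A) (t : I) : segPath f q r t ∈ B :=
  hAB (pathSegment_mem hA hq hr t)

/-- The convex set `A` is contractible, so the homotopy exists in `A`; pushing it along `A → B`
keeps it inside `B`, which a homotopy in `Y` need not do. -/
theorem restrictPath_segPath_trans {f : C(E, Y)} {A : Set E} {B : Set Y} (hA : Convex ℝ A)
    (hAB : MapsTo f A B) {p q r : E} (hp : p ∈ A) (hq : q ∈ A) (hr : r ∈ A) :
    ((restrictPath (segPath f p q) (segPath_mem hA hAB hp hq)).trans
      (restrictPath (segPath f q r) (segPath_mem hA hAB hq hr))).Homotopic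
      (restrictPath (segPath f p r) (segPath_mem hA hAB hp hr)) := by
  have : ContractibleSpace A := hA.contractibleSpace ⟨p, hp⟩
  have hid : MapsTo (ContinuousMap.id E) A A := fun _ h => h
  let g : C(A, B) := ⟨hAB.restrict f A B, f.continuous.continuousOn.mapsToRestrict hAB⟩
  have H := (SimplyConnectedSpace.paths_homotopic
    ((restrictPath (segPath (.id E) p q) (segPath_mem hA hid hp hq)).trans
      (restrictPath (segPath (.id E) q r) (segPath_mem hA hid hq hr)))
      (restrictPath (segPath (.id E) p r) (segPath_mem hA hid hp hr))).map g
  rw [Path.map_trans] at H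
  exact H

end Segment

/-! ### Local transport -/

/-- Transport along homotopy classes of paths in the members of a cover `U` of `Y`, with values in
a category `S`; the transports along a path contained in two members agree. -/
structure LocalTransport {Y : Type*} [TopologicalSpace Y] {ι : Type*} (U : ι → Set Y)
    (S : Type*) [Category S] where
  obj : Y → S
  map (i : ι) {x y : U i} : Path.Homotopic.Quotient x y → (obj x ⟶ obj y)
  map_refl (i : ι) (x : U i) : map i (.refl x) = 𝟙 (obj x)
  map_trans (i : ι) {x y z : U i} (p : Path.Homotopic.Quotient x y)
    (q : Path.Homotopic.Quotient y z) : map i (p.trans q) = map i p ≫ map i q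
  map_eq (i j : ι) {x y : Y} (γ : Path x y) (hi : ∀ t, γ t ∈ U i) (hj : ∀ t, γ t ∈ U j) :
    map i (.mk (restrictPath γ hi)) = map j (.mk (restrictPath γ hj))

namespace LocalTransport

variable {Y : Type*} [TopologicalSpace Y] {ι : Type*} {U : ι → Set Y} {S : Type*} [Category S]
  (L : LocalTransport U S)

/-- Transport along a path of `Y` contained in `U i`. -/
def path (i : ι) {x y : Y} (γ : Path x y) (h : ∀ t, γ t ∈ U i) : L.obj x ⟶ L.obj y :=
  L.map i (.mk (restrictPath γ h))

/-- Endpoints such as `γ.extend 0` and `x` are only propositionally equal; the `eqToHom`s absorb the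
difference. -/
theorem path_congr (i : ι) {x y x' y' : Y} {γ : Path x y} {γ' : Path x' y'}
    (hγ : ∀ t, γ t = γ' t) (h : ∀ t, γ t ∈ U i) (h' : ∀ t, γ' t ∈ U i) (hx : x = x')
    (hy : y = y') :
    L.path i γ h ≫ eqToHom (congrArg L.obj hy) = eqToHom (congrArg L.obj hx) ≫ L.path i γ' h' := by
  subst hx hy
  obtain rfl : γ = γ' := Path.ext (funext hγ)
  simp

/-! ### Parallel families over convex sets: restriction, pullback, uniqueness -/

section Section

variable {E : Type*} [NormedAddCommGroup E] [NormedSpace ℝ E] {f : C(E, Y)}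

theorem path_segPath_trans {A : Set E} (hA : Convex ℝ A) {i : ι} (hAB : MapsTo f A (U i))
    {p q r : E} (hp : p ∈ A) (hq : q ∈ A) (hr : r ∈ A) :
    L.path i (segPath f p q) (segPath_mem hA hAB hp hq) ≫
      L.path i (segPath f q r) (segPath_mem hA hAB hq hr) =
      L.path i (segPath f p r) (segPath_mem hA hAB hp hr) := by
  unfold path
  rw [← L.map_trans]
  exact congrArg _ (Path.Homotopic.Quotient.eq.2 (restrictPath_segPath_trans hA hAB hp hq hr))

theorem path_segPath_self {p : E} {i : ι} (h : ∀ t, segPath f p p t ∈ U i) :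
    L.path i (segPath f p p) h = 𝟙 _ := by
  rw [← L.map_refl i ⟨f p, by simpa using h 0⟩]
  refine congrArg (L.map i) (congrArg Path.Homotopic.Quotient.mk (Path.ext (funext fun t => ?_)))
  apply Subtype.ext
  change f (AffineMap.lineMap p p (t : ℝ)) = f p
  simp

variable {a : S}

/-- A family of morphisms `a ⟶ L.obj (f p)` for `p ∈ A` that is compatible with the transports
along segments. -/
def IsParallel (f : C(E, Y)) (A : Set E) (s : ∀ p ∈ A, a ⟶ L.obj (f p)) : Prop :=
  ∀ (p q : E) (hp : p ∈ A) (hq : q ∈ A) (i : ι) (h : ∀ t, segPath f p q t ∈ U i),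
    s p hp ≫ L.path i (segPath f p q) h = s q hq

variable {L}

theorem IsParallel.mono {A B : Set E} {s : ∀ p ∈ A, a ⟶ L.obj (f p)} (hs : L.IsParallel f A s)
    (hBA : B ⊆ A) : L.IsParallel f B fun p hp => s p (hBA hp) :=
  fun p q hp hq i h => hs p q (hBA hp) (hBA hq) i h

theorem IsParallel.comp {A : Set E} {s : ∀ p ∈ A, a ⟶ L.obj (f p)} (hs : L.IsParallel f A s)
    {b : S} (m : b ⟶ a) : L.IsParallel f A fun p hp => m ≫ s p hp :=
  fun p q hp hq i h => by rw [Category.assoc, hs p q hp hq i h]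

/-- Affine maps carry segments to segments with their parametrisation. -/
theorem IsParallel.comp_affine {E' : Type*} [NormedAddCommGroup E'] [NormedSpace ℝ E']
    {A : Set E} {s : ∀ p ∈ A, a ⟶ L.obj (f p)} (hs : L.IsParallel f A s) (φ : E' →ᴬ[ℝ] E)
    {B : Set E'} (hBA : MapsTo φ B A) :
    L.IsParallel (f.comp ⟨φ, φ.continuous⟩) B fun p hp => s (φ p) (hBA hp) := by
  intro p q hp hq i h
  have key : ∀ t, segPath (f.comp ⟨φ, φ.continuous⟩) p q t = segPath f (φ p) (φ q) t :=
    fun t => congrArg f (φ.toAffineMap.apply_lineMap p q t)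
  have := hs (φ p) (φ q) (hBA hp) (hBA hq) i fun t => key t ▸ h t
  refine Eq.trans (congrArg _ ?_) this
  simpa using L.path_congr i key h (fun t => key t ▸ h t) rfl rfl

theorem IsParallel.congr {A : Set E} (hA : Convex ℝ A) {s : ∀ p ∈ A, a ⟶ L.obj (f p)}
    (hs : L.IsParallel f A s) {f' : C(E, Y)} (hf : EqOn f f' A) :
    L.IsParallel f' A fun p hp => s p hp ≫ eqToHom (congrArg L.obj (hf hp)) := by
  intro p q hp hq i h
  have key : ∀ t, segPath f p q t = segPath f' p q t :=
    fun t => hf (pathSegment_mem hA hp hq t)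
  have h' : ∀ t, segPath f p q t ∈ U i := fun t => key t ▸ h t
  beta_reduce
  rw [Category.assoc, ← L.path_congr i key h' h (hf hp) (hf hq), ← Category.assoc,
    hs p q hp hq i h']

theorem isParallel_path {A : Set E} (hA : Convex ℝ A) {i : ι} (hAB : MapsTo f A (U i)) {p₀ : E}
    (hp₀ : p₀ ∈ A) :
    L.IsParallel f A fun p hp => L.path i (segPath f p₀ p) (segPath_mem hA hAB hp₀ hp) := by
  intro p q hp hq j h
  beta_reduce
  rw [← L.path_segPath_trans hA hAB hp₀ hp hq]
  -- The segment from `p` to `q` may be tested in another member `j`; the local transports agree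
  -- there.
  exact congrArg _ (L.map_eq j i _ _ _)

theorem exists_convex_nhds {i : ι} (hUi : IsOpen (U i)) {p : E} (hp : f p ∈ U i) :
    ∃ N ∈ nhds p, Convex ℝ N ∧ MapsTo f N (U i) := by
  obtain ⟨ε, hε, hN⟩ := Metric.mem_nhds_iff.1 (f.continuous.continuousAt.preimage_mem_nhds
    (hUi.mem_nhds hp))
  exact ⟨_, Metric.ball_mem_nhds p hε, convex_ball p ε, hN⟩

/-- The relation "agreement at `x` implies agreement at `y`" is transitive, and it holds both ways
between points of a small convex neighbourhood mapped into one member. Connectedness of `A` does the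
rest. -/
theorem IsParallel.eq_of_eq (hU : ∀ i, IsOpen (U i)) (hc : ∀ y, ∃ i, y ∈ U i) {A : Set E}
    (hA : Convex ℝ A) {s s' : ∀ p ∈ A, a ⟶ L.obj (f p)} (hs : L.IsParallel f A s)
    (hs' : L.IsParallel f A s') {p q : E} (hp : p ∈ A) (hq : q ∈ A) (h : s p hp = s' p hp) :
    s q hq = s' q hq := by
  let P : E → E → Prop := fun x y => ∀ (hx : x ∈ A) (hy : y ∈ A),
    s x hx = s' x hx → s y hy = s' y hy
  refine hA.isPreconnected.induction₂' P (fun x hx => ?_) (fun x y z hx hy hz hxy hyz _ _ e =>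
    hyz hy hz (hxy hx hy e)) hp hq hp hq h
  obtain ⟨i, hi⟩ := hc (f x)
  obtain ⟨N, hN, hNc, hNU⟩ := exists_convex_nhds (hU i) hi
  have key : ∀ y z, y ∈ N → z ∈ N → P y z := fun y z hyN hzN hy hz e => by
    have hm := segPath_mem hNc hNU hyN hzN
    rw [← hs y z hy hz i hm, ← hs' y z hy hz i hm, e]
  filter_upwards [nhdsWithin_le_nhds hN] with y hy
  exact ⟨key _ _ (mem_of_mem_nhds hN) hy, key _ _ hy (mem_of_mem_nhds hN)⟩

end Section

end LocalTransport

end VanKampen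

namespace VanKampen

open Set unitInterval

theorem extend_lineMap {Y : Type*} [TopologicalSpace Y] {x y : Y} (γ : Path x y) (t : I) :
    γ.extend (AffineMap.lineMap (0 : ℝ) 1 (t : ℝ)) = γ t := by
  have : AffineMap.lineMap (0 : ℝ) 1 (t : ℝ) = (t : ℝ) := by simp [AffineMap.lineMap_apply]
  rw [this, Path.extend_extends']

namespace LocalTransport

variable {Y : Type*} [TopologicalSpace Y] {ι : Type*} {U : ι → Set Y} {S : Type*} [Category S]
  {L : LocalTransport U S}

/-! ### Existence of parallel families over the square and the interval -/

section Section

variable {E : Type*} [NormedAddCommGroup E] [NormedSpace ℝ E] {f : C(E, Y)} {a : S}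

/-- A segment from `A` to `B` is connected and covered by two closed sets, so it meets `A ∩ B`; the
transport splits at such a point. -/
theorem IsParallel.union {A B : Set E} (hA : IsClosed A) (hB : IsClosed B)
    (hAB : Convex ℝ (A ∪ B)) {s : ∀ p ∈ A ∪ B, a ⟶ L.obj (f p)}
    (hsA : L.IsParallel f A fun p hp => s p (.inl hp))
    (hsB : L.IsParallel f B fun p hp => s p (.inr hp)) : L.IsParallel f (A ∪ B) s := by
  intro p q hp hq i h
  have mixed (hne : (segment ℝ p q ∩ A).Nonempty) (hne' : (segment ℝ p q ∩ B).Nonempty) :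
      s p hp ≫ L.path i (segPath f p q) h = s q hq := by
    obtain ⟨m, hm, hmA, hmB⟩ := isPreconnected_closed_iff.1 (convex_segment p q).isPreconnected
      A B hA hB (hAB.segment_subset hp hq) hne hne'
    have hmaps : MapsTo f (segment ℝ p q) (U i) := by
      intro x hx
      rw [← Path.range_segment] at hx
      obtain ⟨t, rfl⟩ := hx
      exact h t
    have step (x y : E) (hx : x ∈ segment ℝ p q) (hy : y ∈ segment ℝ p q)
        (hxy : x ∈ A ∧ y ∈ A ∨ x ∈ B ∧ y ∈ B) :
        s x (hAB.segment_subset hp hq hx) ≫ L.path i (segPath f x y)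
          (segPath_mem (convex_segment p q) hmaps hx hy) =
          s y (hAB.segment_subset hp hq hy) := by
      rcases hxy with ⟨hx, hy⟩ | ⟨hx, hy⟩
      · exact hsA x y hx hy i _
      · exact hsB x y hx hy i _
    have hp' := left_mem_segment ℝ p q
    have hq' := right_mem_segment ℝ p q
    rw [← L.path_segPath_trans (convex_segment p q) hmaps hp' hm hq', ← Category.assoc,
      step p m hp' hm (hp.imp (⟨·, hmA⟩) (⟨·, hmB⟩)), step m q hm hq' (hq.imp (⟨hmA, ·⟩) (⟨hmB, ·⟩))]
  rcases hp with hp | hp <;> rcases hq with hq | hq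
  · exact hsA p q hp hq i h
  · exact mixed ⟨p, left_mem_segment ℝ p q, hp⟩ ⟨q, right_mem_segment ℝ p q, hq⟩
  · exact mixed ⟨q, right_mem_segment ℝ p q, hq⟩ ⟨p, left_mem_segment ℝ p q, hp⟩
  · exact hsB p q hp hq i h

variable (L) in
/-- Every morphism `a ⟶ L.obj (f p)` with `p ∈ A` extends to a parallel family on `A`. -/
def HasSections (f : C(E, Y)) (A : Set E) : Prop :=
  ∀ (a : S) (p : E) (hp : p ∈ A) (m : a ⟶ L.obj (f p)),
    ∃ s : ∀ q ∈ A, a ⟶ L.obj (f q), L.IsParallel f A s ∧ s p hp = m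

theorem HasSections.mono {A B : Set E} (hA : L.HasSections f A) (hBA : B ⊆ A) :
    L.HasSections f B := fun a p hp m =>
  let ⟨_, hs, hsp⟩ := hA a p (hBA hp) m
  ⟨_, hs.mono hBA, hsp⟩

theorem hasSections_of_mapsTo {A : Set E} (hA : Convex ℝ A) {i : ι} (hAB : MapsTo f A (U i)) :
    L.HasSections f A := by
  refine fun a p hp m => ⟨_, (isParallel_path hA hAB hp).comp m, ?_⟩
  rw [path_segPath_self, Category.comp_id]

/-- Extend over `A`, then over `B` from a common point. The two families agree on the convex set `A
∩ B` by uniqueness. -/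
theorem HasSections.union (hU : ∀ i, IsOpen (U i)) (hc : ∀ y, ∃ i, y ∈ U i) {A B : Set E}
    (hA : L.HasSections f A) (hB : L.HasSections f B) (hAc : IsClosed A) (hBc : IsClosed B)
    (hAconv : Convex ℝ A) (hBconv : Convex ℝ B) (hAB : Convex ℝ (A ∪ B))
    (hne : (A ∩ B).Nonempty) : L.HasSections f (A ∪ B) := by
  have half : ∀ {A B : Set E}, L.HasSections f A → L.HasSections f B → IsClosed A → IsClosed B →
      Convex ℝ A → Convex ℝ B → Convex ℝ (A ∪ B) → (A ∩ B).Nonempty →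
      ∀ (a : S) (p : E) (hp : p ∈ A) (m : a ⟶ L.obj (f p)),
        ∃ s : ∀ q ∈ A ∪ B, a ⟶ L.obj (f q), L.IsParallel f (A ∪ B) s ∧ s p (.inl hp) = m := by
    classical
    intro A B hA hB hAc hBc hAconv hBconv hAB ⟨p₁, hp₁A, hp₁B⟩ a p hp m
    obtain ⟨sA, hsA, rfl⟩ := hA a p hp m
    obtain ⟨sB, hsB, hsB₁⟩ := hB a p₁ hp₁B (sA p₁ hp₁A)
    have agree (q : E) (hqA : q ∈ A) (hqB : q ∈ B) : sA q hqA = sB q hqB :=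
      (hsA.mono inter_subset_left).eq_of_eq hU hc (hAconv.inter hBconv)
        (hsB.mono inter_subset_right) ⟨hp₁A, hp₁B⟩ ⟨hqA, hqB⟩ hsB₁.symm
    let s : ∀ q ∈ A ∪ B, a ⟶ L.obj (f q) := fun q hq =>
      if h : q ∈ A then sA q h else sB q (hq.resolve_left h)
    have hs₁ : (fun q hq => s q (.inl hq)) = sA := by
      funext q hq
      exact dif_pos hq
    have hs₂ : (fun q hq => s q (.inr hq)) = sB := by
      funext q hq
      by_cases h : q ∈ A
      · exact (dif_pos h).trans (agree q h hq)
      · exact dif_neg h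
    exact ⟨s, .union hAc hBc hAB (hs₁ ▸ hsA) (hs₂ ▸ hsB), congrFun (congrFun hs₁ p) hp⟩
  intro a p hp m
  rcases hp with hp | hp
  · exact half hA hB hAc hBc hAconv hBconv hAB hne a p hp m
  · obtain ⟨s, hs, hsp⟩ := half hB hA hBc hAc hBconv hAconv (union_comm A B ▸ hAB)
      (inter_comm A B ▸ hne) a p hp m
    exact ⟨_, hs.mono (union_comm A B).le, hsp⟩

/-- A Lebesgue-type grid puts every cell in one member. Cells are glued into rows and rows into the
square, so that every partial union is a rectangle, hence convex. -/
theorem hasSections_unitSquare (hU : ∀ i, IsOpen (U i)) (hc : ∀ y, ∃ i, y ∈ U i)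
    (f : C(ℝ × ℝ, Y)) : L.HasSections f (Icc 0 1 ×ˢ Icc 0 1) := by
  obtain ⟨t, ht₀, htm, ⟨N, hN⟩, ht⟩ := exists_monotone_Icc_subset_open_cover_unitInterval_prod_self
    (c := fun i => {x : I × I | f (x.1, x.2) ∈ U i})
    (fun i => (hU i).preimage (by fun_prop)) (fun x _ => mem_iUnion.2 (hc _))
  have hstep (n : ℕ) : (t n : ℝ) ≤ t (n + 1) := htm n.le_succ
  have small (n m : ℕ) :
      L.HasSections f (Icc (t n : ℝ) (t (n + 1)) ×ˢ Icc (t m : ℝ) (t (m + 1))) := by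
    obtain ⟨i, hi⟩ := ht n m
    refine hasSections_of_mapsTo ((convex_Icc _ _).prod (convex_Icc _ _)) (i := i) ?_
    rintro ⟨x, y⟩ ⟨hx, hy⟩
    exact @hi (⟨x, (t n).2.1.trans hx.1, hx.2.trans (t (n + 1)).2.2⟩,
      ⟨y, (t m).2.1.trans hy.1, hy.2.trans (t (m + 1)).2.2⟩) ⟨hx, hy⟩
  have h0 : (t 0 : ℝ) = 0 := by rw [ht₀]; rfl
  have closed (x y z w : ℝ) : IsClosed (Icc x y ×ˢ Icc z w) := isClosed_Icc.prod isClosed_Icc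
  have conv (x y z w : ℝ) : Convex ℝ (Icc x y ×ˢ Icc z w) := (convex_Icc _ _).prod (convex_Icc _ _)
  have row (m k : ℕ) : L.HasSections f (Icc (0 : ℝ) (t k) ×ˢ Icc (t m : ℝ) (t (m + 1))) := by
    induction k with
    -- The interval degenerates to `{0}`, which lies in the first cell.
    | zero =>
      refine (small 0 m).mono (prod_mono_left ?_)
      rw [h0]
      exact Icc_subset_Icc_right (t 1).2.1
    | succ k ih =>
      have hu := Icc_union_Icc_eq_Icc (t k).2.1 (hstep k)
      rw [← hu, union_prod]
      refine ih.union hU hc (small k m) (closed _ _ _ _) (closed _ _ _ _) (conv _ _ _ _)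
        (conv _ _ _ _) ?_ ⟨(t k, t m), ?_⟩
      · rw [← union_prod, hu]
        exact conv _ _ _ _
      · exact ⟨⟨⟨(t k).2.1, le_rfl⟩, ⟨le_rfl, hstep m⟩⟩, ⟨⟨le_rfl, hstep k⟩, ⟨le_rfl, hstep m⟩⟩⟩
  have row' (m : ℕ) : L.HasSections f (Icc (0 : ℝ) 1 ×ˢ Icc (t m : ℝ) (t (m + 1))) := by
    have := row m N
    rwa [hN N le_rfl] at this
  have column (k : ℕ) : L.HasSections f (Icc (0 : ℝ) 1 ×ˢ Icc (0 : ℝ) (t k)) := by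
    induction k with
    | zero =>
      refine (row' 0).mono (prod_mono_right ?_)
      rw [h0]
      exact Icc_subset_Icc_right (t 1).2.1
    | succ k ih =>
      have hu := Icc_union_Icc_eq_Icc (t k).2.1 (hstep k)
      rw [← hu, prod_union]
      refine ih.union hU hc (row' k) (closed _ _ _ _) (closed _ _ _ _) (conv _ _ _ _)
        (conv _ _ _ _) ?_ ⟨(0, t k), ?_⟩
      · rw [← prod_union, hu]
        exact conv _ _ _ _
      · exact ⟨⟨⟨le_rfl, zero_le_one⟩, ⟨(t k).2.1, le_rfl⟩⟩,
          ⟨⟨le_rfl, zero_le_one⟩, ⟨le_rfl, hstep k⟩⟩⟩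
  have := column N
  rwa [hN N le_rfl] at this

/-- The interval is the edge `{0} × [0, 1]` of the square mapped by `f ∘ Prod.snd`. -/
theorem hasSections_unitInterval (hU : ∀ i, IsOpen (U i)) (hc : ∀ y, ∃ i, y ∈ U i)
    (f : C(ℝ, Y)) : L.HasSections f (Icc 0 1) := by
  intro a p hp m
  have hmaps : MapsTo (ContinuousLinearMap.inr ℝ ℝ ℝ).toContinuousAffineMap (Icc (0 : ℝ) 1)
      (Icc (0 : ℝ) 1 ×ˢ Icc (0 : ℝ) 1) := fun x hx => ⟨⟨le_rfl, zero_le_one⟩, hx⟩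
  obtain ⟨s, hs, hsp⟩ := hasSections_unitSquare (L := L) hU hc
    (f.comp (⟨Prod.snd, continuous_snd⟩ : C(ℝ × ℝ, ℝ))) a _ (hmaps hp) m
  exact ⟨_, hs.comp_affine _ hmaps, hsp⟩

end Section

/-! ### Transport along arbitrary paths -/

theorem exists_section_path (hU : ∀ i, IsOpen (U i)) (hc : ∀ y, ∃ i, y ∈ U i) {x y : Y}
    (γ : Path x y) : ∃ s : ∀ p ∈ Icc (0 : ℝ) 1, L.obj x ⟶ L.obj (γ.extend p),
      L.IsParallel γ.extend (Icc 0 1) s ∧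
        s 0 (left_mem_Icc.2 zero_le_one) = eqToHom (congrArg L.obj γ.extend_zero.symm) :=
  hasSections_unitInterval hU hc _ _ _ _ _

variable (L) in
/-- Transport along an arbitrary path. -/
noncomputable def transport (hU : ∀ i, IsOpen (U i)) (hc : ∀ y, ∃ i, y ∈ U i) {x y : Y}
    (γ : Path x y) : L.obj x ⟶ L.obj y :=
  (exists_section_path hU hc γ).choose 1 (right_mem_Icc.2 zero_le_one) ≫
    eqToHom (congrArg L.obj γ.extend_one)

variable {hU : ∀ i, IsOpen (U i)} {hc : ∀ y, ∃ i, y ∈ U i}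

/-- Pulled back to `[0, 1]` along the segment, `s` is parallel over `γ`; so is `s p` followed by the
family defining `transport`. They agree at `0`, hence at `1`. -/
theorem IsParallel.comp_transport {E : Type*} [NormedAddCommGroup E] [NormedSpace ℝ E]
    {f : C(E, Y)} {a : S} {A : Set E} (hA : Convex ℝ A) {s : ∀ p ∈ A, a ⟶ L.obj (f p)}
    (hs : L.IsParallel f A s) {p q : E} (hp : p ∈ A) (hq : q ∈ A) {x y : Y} (γ : Path x y)
    (hγ : ∀ t : I, f (AffineMap.lineMap p q (t : ℝ)) = γ t) (hx : f p = x) (hy : f q = y) :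
    s p hp ≫ eqToHom (congrArg L.obj hx) ≫ L.transport hU hc γ =
      s q hq ≫ eqToHom (congrArg L.obj hy) := by
  have hmaps : MapsTo (ContinuousAffineMap.lineMap p q : ℝ →ᴬ[ℝ] E) (Icc (0 : ℝ) 1) A :=
    fun t ht => pathSegment_mem hA hp hq ⟨t, ht⟩
  have hcongr (z : E) (hz : z ∈ A) (z' : E) (h : z = z') (hz' : z' ∈ A) :
      s z hz ≫ eqToHom (by rw [h]) = s z' hz' := by
    subst h
    simp
  have heq : EqOn (f.comp ⟨_, (ContinuousAffineMap.lineMap p q : ℝ →ᴬ[ℝ] E).continuous⟩)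
      γ.extend (Icc (0 : ℝ) 1) := fun t ht => by
    rw [γ.extend_apply ht]
    exact hγ ⟨t, ht⟩
  have h₁ := (hs.comp_affine (ContinuousAffineMap.lineMap p q : ℝ →ᴬ[ℝ] E) hmaps).congr
    (convex_Icc 0 1) heq
  obtain ⟨h₂, h₂'⟩ := (exists_section_path (L := L) hU hc γ).choose_spec
  have h₃ := h₂.comp (s p hp ≫ eqToHom (congrArg L.obj hx))
  have := h₁.eq_of_eq hU hc (convex_Icc 0 1) h₃ (left_mem_Icc.2 zero_le_one)
    (right_mem_Icc.2 zero_le_one) (by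
      rw [h₂', ← hcongr p hp (ContinuousAffineMap.lineMap p q (0 : ℝ)) (AffineMap.lineMap_apply_zero p q).symm]
      simp)
  unfold transport
  rw [← Category.assoc, ← Category.assoc, ← this,
    ← hcongr q hq (ContinuousAffineMap.lineMap p q (1 : ℝ)) (AffineMap.lineMap_apply_one p q).symm]
  simp

theorem transport_of_mem {x y : Y} (γ : Path x y) {i : ι} (h : ∀ t, γ t ∈ U i) :
    L.transport hU hc γ = L.path i γ h := by
  have hmaps : MapsTo γ.extend (Icc (0 : ℝ) 1) (U i) := fun t ht => by
    rw [γ.extend_apply ht]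
    exact h _
  have h0 : (0 : ℝ) ∈ Icc (0 : ℝ) 1 := left_mem_Icc.2 zero_le_one
  have h1 : (1 : ℝ) ∈ Icc (0 : ℝ) 1 := right_mem_Icc.2 zero_le_one
  have key (t : I) : γ.extend (AffineMap.lineMap (0 : ℝ) 1 (t : ℝ)) = γ t :=
    extend_lineMap γ t
  have := (isParallel_path (L := L) (convex_Icc 0 1) hmaps h0).comp_transport (hU := hU) (hc := hc)
    (convex_Icc 0 1) h0 h1 γ key γ.extend_zero γ.extend_one
  rw [path_segPath_self, Category.id_comp, L.path_congr i key _ h γ.extend_zero γ.extend_one] at this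
  exact (cancel_epi _).1 this

theorem transport_refl (x : Y) : L.transport hU hc (.refl x) = 𝟙 _ := by
  obtain ⟨i, hi⟩ := hc x
  rw [transport_of_mem _ fun _ => hi]
  exact L.map_refl i ⟨x, hi⟩

theorem transport_trans {x y z : Y} (γ : Path x y) (γ' : Path y z) :
    L.transport hU hc (γ.trans γ') = L.transport hU hc γ ≫ L.transport hU hc γ' := by
  -- One parallel family along the concatenation is read over `[0, 1/2]`, `[1/2, 1]` and `[0, 1]`.
  obtain ⟨s, hs, hs₀⟩ := exists_section_path (L := L) hU hc (γ.trans γ')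
  have h0 : (0 : ℝ) ∈ Icc (0 : ℝ) 1 := left_mem_Icc.2 zero_le_one
  have h1 : (1 : ℝ) ∈ Icc (0 : ℝ) 1 := right_mem_Icc.2 zero_le_one
  have h2 : (1 / 2 : ℝ) ∈ Icc (0 : ℝ) 1 := by constructor <;> norm_num
  have e₁ (t : I) : (γ.trans γ').extend (AffineMap.lineMap (0 : ℝ) (1 / 2) (t : ℝ)) = γ t := by
    have : AffineMap.lineMap (0 : ℝ) (1 / 2) (t : ℝ) = (t : ℝ) / 2 := by
      simp [AffineMap.lineMap_apply, div_eq_mul_inv]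
    rw [this, Path.extend_trans_of_le_half _ _ (by linarith [t.2.2]), mul_div_cancel₀ _ two_ne_zero,
      Path.extend_extends']
  have e₂ (t : I) : (γ.trans γ').extend (AffineMap.lineMap (1 / 2 : ℝ) 1 (t : ℝ)) = γ' t := by
    have : AffineMap.lineMap (1 / 2 : ℝ) 1 (t : ℝ) = ((t : ℝ) + 1) / 2 := by
      simp [AffineMap.lineMap_apply]
      ring
    rw [this, Path.extend_trans_of_half_le _ _ (by linarith [t.2.1]),
      mul_div_cancel₀ _ two_ne_zero, add_sub_cancel_right, Path.extend_extends']
  have k₁ := hs.comp_transport (hU := hU) (hc := hc) (convex_Icc 0 1) h0 h2 γ e₁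
    (by simp) (by simpa using e₁ 1)
  have k₂ := hs.comp_transport (hU := hU) (hc := hc) (convex_Icc 0 1) h2 h1 γ' e₂
    (by simpa using e₂ 0) (by simp)
  have k₃ := hs.comp_transport (hU := hU) (hc := hc) (convex_Icc 0 1) h0 h1 (γ.trans γ')
    (extend_lineMap _) (by simp) (by simp)
  rw [← k₂, reassoc_of% k₁.symm, hs₀] at k₃
  simpa using k₃

/-- Take a parallel family over the square of the homotopy. Two opposite sides are `γ` and `γ'`; the
other two are constant paths, with trivial transport. -/
theorem transport_eq_of_homotopic {x y : Y} {γ γ' : Path x y} (h : γ.Homotopic γ') :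
    L.transport hU hc γ = L.transport hU hc γ' := by
  obtain ⟨H⟩ := h
  let f : C(ℝ × ℝ, Y) := ⟨fun z => H (projIcc 0 1 zero_le_one z.1, projIcc 0 1 zero_le_one z.2),
    by fun_prop⟩
  have f_apply (u v : I) : f ((u : ℝ), (v : ℝ)) = H (u, v) := by simp [f]
  have h0 : (0 : ℝ) ∈ Icc (0 : ℝ) 1 := left_mem_Icc.2 zero_le_one
  have h1 : (1 : ℝ) ∈ Icc (0 : ℝ) 1 := right_mem_Icc.2 zero_le_one
  have lineMap_left (u : ℝ) (t : I) :
      AffineMap.lineMap ((0 : ℝ), u) ((1 : ℝ), u) (t : ℝ) = ((t : ℝ), u) := by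
    ext <;> simp [AffineMap.lineMap_apply]
  have lineMap_right (u : ℝ) (t : I) :
      AffineMap.lineMap (u, (0 : ℝ)) (u, (1 : ℝ)) (t : ℝ) = (u, (t : ℝ)) := by
    ext <;> simp [AffineMap.lineMap_apply]
  have f00 : f (0, 0) = x := (f_apply 0 0).trans (by simp)
  have f01 : f (0, 1) = y := (f_apply 0 1).trans (by simp)
  have f10 : f (1, 0) = x := (f_apply 1 0).trans (by simp)
  have f11 : f (1, 1) = y := (f_apply 1 1).trans (by simp)
  obtain ⟨s, hs, hs₀⟩ := hasSections_unitSquare (L := L) hU hc f (L.obj x) (0, 0) ⟨h0, h0⟩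
    (eqToHom (congrArg L.obj f00.symm))
  have hA : Convex ℝ (Icc (0 : ℝ) 1 ×ˢ Icc (0 : ℝ) 1) := (convex_Icc _ _).prod (convex_Icc _ _)
  have bottom := hs.comp_transport (hU := hU) (hc := hc) hA ⟨h0, h0⟩ ⟨h0, h1⟩ γ
    (fun t => by rw [lineMap_right]; exact (f_apply 0 t).trans (by simp)) f00 f01
  have top := hs.comp_transport (hU := hU) (hc := hc) hA ⟨h1, h0⟩ ⟨h1, h1⟩ γ'
    (fun t => by rw [lineMap_right]; exact (f_apply 1 t).trans (by simp)) f10 f11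
  have left := hs.comp_transport (hU := hU) (hc := hc) hA ⟨h0, h0⟩ ⟨h1, h0⟩ (.refl x)
    (fun t => by rw [lineMap_left]; exact (f_apply t 0).trans (by simp)) f00 f10
  have right := hs.comp_transport (hU := hU) (hc := hc) hA ⟨h0, h1⟩ ⟨h1, h1⟩ (.refl y)
    (fun t => by rw [lineMap_left]; exact (f_apply t 1).trans (by simp)) f01 f11
  rw [transport_refl, Category.comp_id] at left right
  rw [← right, ← bottom, ← Category.assoc, ← left, hs₀] at top
  simpa using top.symm

variable (L hU hc) in
/-- The functor on the fundamental groupoid obtained by glueing local transports. -/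
noncomputable def functor : FundamentalGroupoid Y ⥤ S where
  obj x := L.obj x.as
  map {x y} := Quotient.lift (L.transport hU hc) fun _ _ => transport_eq_of_homotopic
  map_id x := transport_refl x.as
  map_comp := by
    rintro _ _ _ ⟨γ⟩ ⟨γ'⟩
    exact transport_trans γ γ'

theorem functor_map_of_mem {x y : Y} (γ : Path x y) {i : ι} (h : ∀ t, γ t ∈ U i) :
    (L.functor hU hc).map (FundamentalGroupoid.fromPath (.mk γ)) = L.path i γ h :=
  transport_of_mem (hU := hU) (hc := hc) γ h

end LocalTransport

/-! ### Generation of path classes by paths inside members -/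

/-- Every homotopy class of paths is a composite of classes of paths contained in members of a
given open cover. -/
theorem homotopicQuotient_induction {Y : Type*} [TopologicalSpace Y] {ι : Type*} {U : ι → Set Y}
    (hU : ∀ i, IsOpen (U i)) (hc : ∀ y, ∃ i, y ∈ U i)
    {P : ∀ {x y : Y}, Path.Homotopic.Quotient x y → Prop}
    (mem : ∀ {x y : Y} (γ : Path x y) (i : ι), (∀ t, γ t ∈ U i) → P (.mk γ))
    (trans : ∀ {x y z : Y} (p : Path.Homotopic.Quotient x y) (q : Path.Homotopic.Quotient y z),
      P p → P q → P (p.trans q)) {x y : Y} (p : Path.Homotopic.Quotient x y) : P p := by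
  induction p using Path.Homotopic.Quotient.ind with | mk γ => ?_
  have key : P (.mk (segPath γ.extend 0 1)) := by
    -- The relation on `(s, t)` holds locally in both directions, and it is transitive because paths
    -- in `ℝ` with equal endpoints are homotopic.
    refine (convex_univ (𝕜 := ℝ) (E := ℝ)).isPreconnected.induction₂'
      (fun s t => P (.mk (segPath γ.extend s t))) (fun s _ => ?_) (fun s t r _ _ _ hst htr => ?_)
      (mem_univ 0) (mem_univ 1)
    · obtain ⟨i, hi⟩ := hc (γ.extend s)
      obtain ⟨N, hN, hNc, hNU⟩ := LocalTransport.exists_convex_nhds (hU i) hi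
      filter_upwards [nhdsWithin_le_nhds hN] with t ht
      have hs := mem_of_mem_nhds hN
      exact ⟨mem _ i (segPath_mem hNc hNU hs ht), mem _ i (segPath_mem hNc hNU ht hs)⟩
    · have : Path.Homotopic.Quotient.mk (segPath γ.extend s r) =
          (Path.Homotopic.Quotient.mk (segPath γ.extend s t)).trans
            (.mk (segPath γ.extend t r)) := by
        refine Path.Homotopic.Quotient.eq.2 (.symm ?_)
        have := (SimplyConnectedSpace.paths_homotopic
          ((Path.segment s t).trans (Path.segment t r)) (Path.segment s r)).map γ.extend
        rwa [Path.map_trans] at this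
      rw [this]
      exact trans _ _ hst htr
  have congr {x y x' y' : Y} (hx : x = x') (hy : y = y') {γ : Path x y} {γ' : Path x' y'}
      (h : ∀ t, γ t = γ' t) (hP : P (.mk γ)) : P (.mk γ') := by
    subst hx hy
    obtain rfl : γ = γ' := Path.ext (funext h)
    exact hP
  exact congr (by simp) (by simp) (extend_lineMap γ) key

end VanKampen

namespace VanKampen

open Set unitInterval

/-! ### Descent data and the glued functor -/

section Descent

variable {X : Type*} [TopologicalSpace X] {ι : Type*}

/-- The functor of fundamental groupoids induced by an inclusion of subspaces. -/
noncomputable abbrev inclusionFunctor {A B : Set X} (h : A ⊆ B) : FundamentalGroupoid A ⥤ FundamentalGroupoid B :=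
  FundamentalGroupoid.map ⟨inclusion h, continuous_inclusion h⟩

/-- The projection to `A` of the trace of `A` on a subspace `V`. -/
def ofTrace (V A : Set X) : C(((↑) : V → X) ⁻¹' A, A) := ⟨fun z => ⟨z.1.1, z.2⟩, by fun_prop⟩

/-- The class of a path contained in `A` as a morphism of the fundamental groupoid of `A`. -/
noncomputable abbrev pathClass {A : Set X} {x y : X} (γ : Path x y) (h : ∀ t, γ t ∈ A) :
    FundamentalGroupoid.mk (⟨x, by simpa using h 0⟩ : A) ⟶
      FundamentalGroupoid.mk (⟨y, by simpa using h 1⟩ : A) :=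
  FundamentalGroupoid.fromPath (.mk (restrictPath γ h))

/-- Functors on the fundamental groupoids of the members of a family of subspaces, identified on
the pairwise intersections subject to the cocycle condition. -/
structure DescentDatum (W : ι → Set X) (S : Type*) [Groupoid S] where
  leg (i : ι) : FundamentalGroupoid (W i) ⥤ S
  glue (i j : ι) (x : X) (hi : x ∈ W i) (hj : x ∈ W j) : (leg i).obj ⟨⟨x, hi⟩⟩ ⟶ (leg j).obj ⟨⟨x, hj⟩⟩
  glue_glue (i j k : ι) (x : X) (hi : x ∈ W i) (hj : x ∈ W j) (hk : x ∈ W k) :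
    glue i j x hi hj ≫ glue j k x hj hk = glue i k x hi hk
  naturality (i j : ι) {x y : X} (γ : Path x y) (hi : ∀ t, γ t ∈ W i) (hj : ∀ t, γ t ∈ W j) :
    (leg i).map (pathClass γ hi) ≫ glue i j y (by simpa using hi 1) (by simpa using hj 1) =
      glue i j x (by simpa using hi 0) (by simpa using hj 0) ≫ (leg j).map (pathClass γ hj)

namespace DescentDatum

variable {W : ι → Set X} {S : Type*} [Groupoid S] (D : DescentDatum W S)

theorem glue_self (i : ι) (x : X) (hi : x ∈ W i) : D.glue i i x hi hi = 𝟙 _ := by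
  rw [← cancel_epi (D.glue i i x hi hi), D.glue_glue, Category.comp_id]

/-- The value of a leg on a class of paths in the trace of `W i` on a subspace. -/
noncomputable def traceMap {V : Set X} (i : ι) {x y : ((↑) : V → X) ⁻¹' W i} (p : Path.Homotopic.Quotient x y) :
    (D.leg i).obj ⟨⟨x, x.2⟩⟩ ⟶ (D.leg i).obj ⟨⟨y, y.2⟩⟩ :=
  (FundamentalGroupoid.map (ofTrace V (W i)) ⋙ D.leg i).map (FundamentalGroupoid.fromPath p)

theorem traceMap_refl {V : Set X} (i : ι) (x : ((↑) : V → X) ⁻¹' W i) :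
    D.traceMap i (.refl x) = 𝟙 _ :=
  (FundamentalGroupoid.map (ofTrace V (W i)) ⋙ D.leg i).map_id ⟨x⟩

theorem traceMap_trans {V : Set X} (i : ι) {x y z : ((↑) : V → X) ⁻¹' W i}
    (p : Path.Homotopic.Quotient x y) (q : Path.Homotopic.Quotient y z) :
    D.traceMap i (p.trans q) = D.traceMap i p ≫ D.traceMap i q :=
  (FundamentalGroupoid.map (ofTrace V (W i)) ⋙ D.leg i).map_comp
    (FundamentalGroupoid.fromPath p) (FundamentalGroupoid.fromPath q)

variable {V : Set X} (hc : ∀ y : V, ∃ i, (y : X) ∈ W i)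

/-- The local transport on `V` obtained by choosing for each point a member of the cover. -/
noncomputable def localTransport : LocalTransport (fun i => ((↑) : V → X) ⁻¹' W i) S where
  obj y := (D.leg (hc y).choose).obj ⟨⟨y, (hc y).choose_spec⟩⟩
  map i {x y} p := D.glue _ i x (hc x).choose_spec x.2 ≫ D.traceMap i p ≫
    D.glue i _ y y.2 (hc y).choose_spec
  map_refl i x := by rw [traceMap_refl, Category.id_comp, D.glue_glue, D.glue_self]
  map_trans i x y z p q := by
    have hy : D.glue i _ y y.2 (hc y).choose_spec ≫ D.glue _ i y (hc y).choose_spec y.2 = 𝟙 _ := by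
      rw [D.glue_glue, D.glue_self]
    simp only [Category.assoc, traceMap_trans, reassoc_of% hy]
  map_eq i j {x y} γ hi hj := by
    have := D.naturality i j (γ.map continuous_subtype_val) hi hj
    change _ ≫ (D.leg i).map (pathClass (γ.map continuous_subtype_val) hi) ≫ _ =
      _ ≫ (D.leg j).map (pathClass (γ.map continuous_subtype_val) hj) ≫ _
    -- Route the gluing into `j` through `i`, move `glue i j` past `γ` by naturality, and absorb it
    -- into the last gluing.
    rw [← D.glue_glue _ i j x (hc x).choose_spec (by simpa using hi 0) (by simpa using hj 0),
      Category.assoc, ← reassoc_of% this, D.glue_glue]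

/-- The functor on the fundamental groupoid of `V` obtained from a descent datum. -/
noncomputable def functor (hW : ∀ i, IsOpen (W i)) : FundamentalGroupoid V ⥤ S :=
  (D.localTransport hc).functor (fun i => (hW i).preimage continuous_subtype_val) hc

/-- The restriction of the glued functor to a member of the cover. -/
noncomputable def comparison (hW : ∀ i, IsOpen (W i)) (hV : ∀ i, W i ⊆ V) (i : ι) :
    inclusionFunctor (hV i) ⋙ D.functor hc hW ⟶ D.leg i where
  app x := D.glue _ i x.as (hc ⟨x.as, hV i x.as.2⟩).choose_spec x.as.2
  naturality := by
    rintro ⟨x⟩ ⟨y⟩ ⟨γ⟩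
    have hγ : ∀ t, γ.map (continuous_inclusion (hV i)) t ∈ ((↑) : V → X) ⁻¹' W i := fun t => (γ t).2
    have := (D.localTransport hc).functor_map_of_mem
      (hU := fun i => (hW i).preimage continuous_subtype_val) (hc := hc) _ hγ
    refine (congrArg (· ≫ _) this).trans ?_
    have cancel (a : S) (f : a ⟶ (D.leg i).obj ⟨x⟩) (g : (D.leg i).obj ⟨x⟩ ⟶ (D.leg i).obj ⟨y⟩)
        (k : ι) (hk : (y : X) ∈ W k) :
        (f ≫ g ≫ D.glue i k y y.2 hk) ≫ D.glue k i y hk y.2 = f ≫ g := by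
      rw [Category.assoc, Category.assoc, D.glue_glue, D.glue_self, Category.comp_id]
    exact cancel _ _ _ _ _

theorem comparison_app_glue (hW : ∀ i, IsOpen (W i)) (hV : ∀ i, W i ⊆ V) (i j : ι) (x : X)
    (hi : x ∈ W i) (hj : x ∈ W j) :
    (D.comparison hc hW hV i).app ⟨⟨x, hi⟩⟩ ≫ D.glue i j x hi hj =
      (D.comparison hc hW hV j).app ⟨⟨x, hj⟩⟩ :=
  D.glue_glue _ _ _ _ _ _ _

end DescentDatum

/-- Naturality squares paste under composition, so they need checking only on generating path
classes. -/
theorem naturality_of_cover {W : ι → Set X} (hW : ∀ i, IsOpen (W i)) {V : Set X}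
    (hV : ∀ i, W i ⊆ V) (hc : ∀ y : V, ∃ i, (y : X) ∈ W i) {S : Type*} [Category S]
    {F G : FundamentalGroupoid V ⥤ S} (τ : ∀ x, F.obj x ⟶ G.obj x)
    (h : ∀ i {x y : FundamentalGroupoid (W i)} (p : x ⟶ y),
      F.map ((inclusionFunctor (hV i)).map p) ≫ τ _ = τ _ ≫ G.map ((inclusionFunctor (hV i)).map p))
    {x y : FundamentalGroupoid V} (p : x ⟶ y) : F.map p ≫ τ y = τ x ≫ G.map p := by
  refine homotopicQuotient_induction (U := fun i => ((↑) : V → X) ⁻¹' W i)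
    (P := fun {x y} p => F.map (FundamentalGroupoid.fromPath p) ≫ τ ⟨y⟩ =
      τ ⟨x⟩ ≫ G.map (FundamentalGroupoid.fromPath p))
    (fun i => (hW i).preimage continuous_subtype_val) hc (fun γ i hγ => ?_)
    (fun {x y z} p q hp hq => ?_) p
  · exact h i (pathClass (γ.map continuous_subtype_val) hγ)
  · have hF := F.map_comp (FundamentalGroupoid.fromPath p) (FundamentalGroupoid.fromPath q)
    have hG := G.map_comp (FundamentalGroupoid.fromPath p) (FundamentalGroupoid.fromPath q)
    change F.map (FundamentalGroupoid.fromPath p ≫ FundamentalGroupoid.fromPath q) ≫ _ =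
      _ ≫ G.map (FundamentalGroupoid.fromPath p ≫ FundamentalGroupoid.fromPath q)
    rw [hF, hG, Category.assoc, hq, reassoc_of% hp]

end Descent

end VanKampen

/-! ### The cosheaf property -/

namespace VanKampen

open Set

/-- Upgrades the comparison of a glued functor with a leg to the strict equality that a coequaliser
demands. -/
theorem functor_eq_of_app_eq_eqToHom {C D : Type*} [Category C] [Category D] {F G : C ⥤ D}
    (α : F ⟶ G) (hobj : ∀ x, F.obj x = G.obj x) (h : ∀ x, α.app x = eqToHom (hobj x)) : F = G := by
  refine CategoryTheory.Functor.ext hobj fun x y f => ?_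
  have := α.naturality f
  rw [h, h] at this
  rw [← Category.assoc, ← this, Category.assoc, eqToHom_trans, eqToHom_refl, Category.comp_id]

theorem map_comp_eqToHom_of_eq {C D : Type*} [Category C] [Category D] {F G : C ⥤ D} (h : F = G)
    {x y : C} (f : x ⟶ y) :
    F.map f ≫ eqToHom (Functor.congr_obj h y) = eqToHom (Functor.congr_obj h x) ≫ G.map f := by
  subst h
  simp

theorem functor_ext_of_cover {X : Type*} [TopologicalSpace X] {ι : Type*} {W : ι → Set X}
    (hW : ∀ i, IsOpen (W i)) {V : Set X} (hV : ∀ i, W i ⊆ V) (hc : ∀ y : V, ∃ i, (y : X) ∈ W i)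
    {S : Type*} [Category S] {F G : FundamentalGroupoid V ⥤ S}
    (h : ∀ i, inclusionFunctor (hV i) ⋙ F = inclusionFunctor (hV i) ⋙ G) : F = G := by
  have hobj (x) : F.obj x = G.obj x := by
    obtain ⟨i, hi⟩ := hc x.as
    exact Functor.congr_obj (h i) ⟨⟨x.as, hi⟩⟩
  refine functor_eq_of_app_eq_eqToHom ⟨fun x => eqToHom (hobj x), fun x y p => ?_⟩ hobj
    fun _ => rfl
  exact naturality_of_cover hW hV hc (fun x => eqToHom (hobj x))
    (fun i _ _ p => map_comp_eqToHom_of_eq (h i) p) p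

section

variable {X : Type u} [TopologicalSpace X] {ι : Type u} {U : ι → Opens X} {V : Opens X}

theorem exists_mem_of_iSup_eq (hU : ⨆ i, U i = V) (y : (V : Set X)) : ∃ i, (y : X) ∈ (U i : Set X) := by
  exact Opens.mem_iSup.1 (hU.ge y.2)

/-- The descent datum of a functor on `∐ᵢ Π₁(Uᵢ)` that coequalises the two restriction functors. -/
noncomputable def coequalisingDescentDatum {S : Grpd.{u, u}}
    (π : coprod (fun i => (fundamentalGroupoid X).obj (U i)) ⟶ S)
    (hπ : b₀ (fundamentalGroupoid X) U ≫ π = b₁ (fundamentalGroupoid X) U ≫ π) :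
    DescentDatum (fun i => (U i : Set X)) S where
  leg i := coprodIncl (fun i => (fundamentalGroupoid X).obj (U i)) i ≫ π
  glue i j x hi hj := eqToHom (Functor.congr_obj hπ ⟨(i, j), ⟨⟨x, hi, hj⟩⟩⟩)
  glue_glue i j k x hi hj hk := eqToHom_trans _ _
  naturality i j {x y} γ hi hj := by
    exact map_comp_eqToHom_of_eq hπ (x := ⟨(i, j), ⟨⟨x, by simpa using hi 0, by simpa using hj 0⟩⟩⟩)
      (y := ⟨(i, j), ⟨⟨y, by simpa using hi 1, by simpa using hj 1⟩⟩⟩)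
      (.mk (pathClass (A := ((U i ⊓ U j : Opens X) : Set X)) γ fun t => ⟨hi t, hj t⟩))

theorem isCosheaf_fundamentalGroupoid : IsCosheaf (fundamentalGroupoid X) := by
  intro V ι U hU
  have hle (i : ι) : U i ≤ V := (le_iSup U i).trans hU.le
  refine ⟨Limits.Cofork.IsColimit.ofExistsUnique fun s => ?_⟩
  have hπ := s.condition
  let D := coequalisingDescentDatum s.π hπ
  have hW (i : ι) : IsOpen (U i : Set X) := (U i).isOpen
  have hc := exists_mem_of_iSup_eq hU
  have fac (i : ι) : inclusionFunctor (hle i) ⋙ D.functor hc hW = D.leg i :=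
    functor_eq_of_app_eq_eqToHom (D.comparison hc hW hle i)
      -- The index `_` is the member chosen at the point, so the component of `comparison` is an
      -- `eqToHom` by definition.
      (fun x => Functor.congr_obj hπ ⟨(_, i), ⟨⟨x.as, (hc ⟨x.as, hle i x.as.2⟩).choose_spec,
        x.as.2⟩⟩⟩) fun x => rfl
  refine ⟨D.functor hc hW, coprod_hom_ext fac, fun m hm => ?_⟩
  exact functor_ext_of_cover hW hle hc fun i =>
    (congrArg (coprodIncl (fun i => (fundamentalGroupoid X).obj (U i)) i ≫ ·) hm).trans (fac i).symm

end

end VanKampen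

/-! ### Descent data from pseudo-cocones under the Čech diagram -/

namespace VanKampen

open Set

/-- Gives naturality of `pairHom`: `f` and `g` are the values on two members, `m` the value on their
intersection. -/
theorem comp_inv_square {C : Type*} [Groupoid C] {a a' b b' d d' : C} {f : a ⟶ a'} {g : b ⟶ b'}
    {m : d ⟶ d'} {s : a ⟶ d} {s' : a' ⟶ d'} {t : b ⟶ d} {t' : b' ⟶ d'} (hf : f ≫ s' = s ≫ m)
    (hg : g ≫ t' = t ≫ m) : f ≫ s' ≫ Groupoid.inv t' = (s ≫ Groupoid.inv t) ≫ g := by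
  rw [← cancel_mono t']
  simp [hf, hg]

namespace CechShape

/-- The morphism `[m] ⟶ [0]` given by the vertex `k`. -/
def vertex (m : CechShape) (k : Fin (m.deg.val + 1)) : m ⟶ ⟨0⟩ :=
  OrderEmbedding.ofStrictMono (fun _ : Fin 1 => k) fun a b h =>
    absurd (Subsingleton.elim (α := Fin 1) a b) h.ne

/-- The morphism `[m] ⟶ [1]` given by the edge from `k` to `l`. -/
def edge (m : CechShape) {k l : Fin (m.deg.val + 1)} (h : k < l) : m ⟶ ⟨1⟩ :=
  OrderEmbedding.ofStrictMono ![k, l] <| by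
    rw [Fin.strictMono_iff_lt_succ]
    intro i
    fin_cases i
    exact h

end CechShape

section

variable {X : Type u} [TopologicalSpace X] {ι : Type u} {U : ι → Opens X}

variable (U) in
/-- The member `i` of a cover, as the intersection of a family with one index. -/
abbrev cechMember (i : ι) : Set X := cechOpen U fun _ : Fin 1 => i

theorem mem_cechOpen {n : ℕ} {σ : Fin n → ι} {x : X} : x ∈ cechOpen U σ ↔ ∀ k, x ∈ U (σ k) :=
  Set.mem_iInter

theorem mem_cechMember {i : ι} {x : X} : x ∈ cechMember U i ↔ x ∈ U i :=
  mem_cechOpen.trans ⟨fun h => h 0, fun h _ => h⟩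

theorem mem_cechMember_of_mem {n : ℕ} {σ : Fin n → ι} {x : X} (hx : x ∈ (cechOpen U σ : Set X))
    (k : Fin n) : x ∈ cechMember U (σ k) := mem_cechMember.2 (mem_cechOpen.1 hx k)

theorem cechOpen_subset_cechMember {n : ℕ} (σ : Fin n → ι) (k : Fin n) :
    (cechOpen U σ : Set X) ⊆ cechMember U (σ k) := fun _ hx => mem_cechMember_of_mem hx k

theorem mem_cechOpen_pair {i j : ι} {x : X} (hi : x ∈ cechMember U i) (hj : x ∈ cechMember U j) :
    x ∈ (cechOpen U ![i, j] : Set X) :=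
  mem_cechOpen.2 (Fin.forall_fin_two.2 ⟨mem_cechMember.1 hi, mem_cechMember.1 hj⟩)

theorem isOpen_cechMember (i : ι) : IsOpen (cechMember U i) := (cechOpen U fun _ : Fin 1 => i).isOpen

theorem exists_mem_cechMember {V : Opens X} (hU : ⨆ i, U i = V) (y : (V : Set X)) :
    ∃ i, (y : X) ∈ cechMember U i :=
  (exists_mem_of_iSup_eq hU y).imp fun _ => mem_cechMember.2

theorem cechMember_subset {V : Opens X} (hU : ⨆ i, U i = V) (i : ι) : cechMember U i ⊆ V :=
  fun _ hx => hU.le (Opens.mem_iSup.2 ⟨i, mem_cechMember.1 hx⟩)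

namespace PseudoCocone

variable {S : Grpd.{u, u}} (c : PseudoCocone (cechDiagram U (fundamentalGroupoid X)) S)

/-- The restriction of a leg of a pseudo-cocone to the summand indexed by `σ`. -/
noncomputable def summand (m : CechShape) (σ : Fin (m.deg.val + 1) → ι) :
    FundamentalGroupoid (cechOpen U σ : Set X) ⥤ S :=
  coprodIncl (fun σ : Fin (m.deg.val + 1) → ι => (fundamentalGroupoid X).obj (cechOpen U σ)) σ ⋙
    c.leg m

/-- The isomorphism between the summand `σ` and the summand of its `k`-th vertex. -/
noncomputable def vertexHom {m : CechShape} (σ : Fin (m.deg.val + 1) → ι)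
    (k : Fin (m.deg.val + 1)) :
    inclusionFunctor (cechOpen_subset_cechMember σ k) ⋙ c.summand ⟨0⟩ (fun _ => σ k) ⟶
      c.summand m σ where
  app x := (c.iso (m.vertex k)).hom.app ⟨σ, x⟩
  naturality x y p := (c.iso (m.vertex k)).hom.naturality (X := ⟨σ, x⟩) (Y := ⟨σ, y⟩) (.mk p)

/-- The structure morphism of a face map on the summand `σ`. -/
noncomputable def faceHom {m n : CechShape} (f : m ⟶ n) (σ : Fin (m.deg.val + 1) → ι) (x : X)
    (hx : x ∈ (cechOpen U σ : Set X)) :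
    (c.summand n (σ ∘ CechShape.toFun f)).obj ⟨⟨x, cechOpen_le U σ _ hx⟩⟩ ⟶
      (c.summand m σ).obj ⟨⟨x, hx⟩⟩ :=
  (c.iso f).hom.app ⟨σ, ⟨⟨x, hx⟩⟩⟩

/-- This is `iso_comp` for `f` followed by the vertex `k`; the `eqToHom` there is an identity. -/
theorem vertexHom_faceHom {m n : CechShape} (f : m ⟶ n) (σ : Fin (m.deg.val + 1) → ι) (x : X)
    (hx : x ∈ (cechOpen U σ : Set X)) (k : Fin (n.deg.val + 1)) :
    (c.vertexHom (σ ∘ CechShape.toFun f) k).app ⟨⟨x, cechOpen_le U σ _ hx⟩⟩ ≫ c.faceHom f σ x hx =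
      (c.vertexHom σ (CechShape.toFun f k)).app ⟨⟨x, hx⟩⟩ :=
  ((c.iso_comp f (n.vertex k) ⟨σ, ⟨⟨x, hx⟩⟩⟩).trans (Category.id_comp _)).symm

/-- The gluing morphism on the intersection of two members of the cover. -/
noncomputable def pairHom (i j : ι) (x : X) (hi : x ∈ cechMember U i) (hj : x ∈ cechMember U j) :
    (c.summand ⟨0⟩ fun _ => i).obj ⟨⟨x, hi⟩⟩ ⟶ (c.summand ⟨0⟩ fun _ => j).obj ⟨⟨x, hj⟩⟩ :=
  (c.vertexHom (m := ⟨1⟩) ![i, j] 0).app ⟨⟨x, mem_cechOpen_pair hi hj⟩⟩ ≫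
    Groupoid.inv ((c.vertexHom (m := ⟨1⟩) ![i, j] 1).app ⟨⟨x, mem_cechOpen_pair hi hj⟩⟩)

/-- `pairHom` uses the literal family `![i, j]`, to which `ρ` is only propositionally equal. -/
theorem pairHom_vertexHom_one (ρ : Fin 2 → ι) (x : X) (hx : x ∈ (cechOpen U ρ : Set X)) :
    c.pairHom (ρ 0) (ρ 1) x (mem_cechMember_of_mem hx 0) (mem_cechMember_of_mem hx 1) ≫
      (c.vertexHom (m := ⟨1⟩) ρ 1).app ⟨⟨x, hx⟩⟩ = (c.vertexHom (m := ⟨1⟩) ρ 0).app ⟨⟨x, hx⟩⟩ := by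
  obtain ⟨i, j, rfl⟩ : ∃ i j, ρ = ![i, j] :=
    ⟨ρ 0, ρ 1, funext (Fin.forall_fin_two.2 ⟨rfl, rfl⟩)⟩
  exact (Category.assoc _ _ _).trans
    ((congrArg _ (Groupoid.inv_comp _)).trans (Category.comp_id _))

/-- The relation on the double intersection is carried to `σ` by the face map of the edge from `k`
to `l`. -/
theorem pairHom_vertexHom {m : CechShape} (σ : Fin (m.deg.val + 1) → ι) {k l : Fin (m.deg.val + 1)}
    (h : k < l) (x : X) (hx : x ∈ (cechOpen U σ : Set X)) :
    c.pairHom (σ k) (σ l) x (mem_cechMember_of_mem hx k) (mem_cechMember_of_mem hx l) ≫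
      (c.vertexHom σ l).app ⟨⟨x, hx⟩⟩ = (c.vertexHom σ k).app ⟨⟨x, hx⟩⟩ := by
  have h₀ := c.vertexHom_faceHom (m.edge h) σ x hx 0
  have h₁ := c.vertexHom_faceHom (m.edge h) σ x hx 1
  have h₂ := c.pairHom_vertexHom_one (σ ∘ CechShape.toFun (m.edge h)) x (cechOpen_le U σ _ hx)
  refine (congrArg (_ ≫ ·) h₁.symm).trans (Eq.trans ?_ h₀)
  exact (Category.assoc _ _ _).symm.trans (congrArg (· ≫ _) h₂)

/-- The descent datum of a pseudo-cocone under the Čech diagram. -/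
noncomputable def descentDatum : DescentDatum (cechMember U) S where
  leg i := c.summand ⟨0⟩ fun _ => i
  glue := c.pairHom
  glue_glue i j k x hi hj hk := by
    have hx : x ∈ (cechOpen U ![i, j, k] : Set X) := by
      refine mem_cechOpen.2 fun l => ?_
      fin_cases l
      exacts [mem_cechMember.1 hi, mem_cechMember.1 hj, mem_cechMember.1 hk]
    have h₀₁ := c.pairHom_vertexHom (m := ⟨2⟩) ![i, j, k] (k := 0) (l := 1) (by decide) x hx
    have h₁₂ := c.pairHom_vertexHom (m := ⟨2⟩) ![i, j, k] (k := 1) (l := 2) (by decide) x hx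
    have h₀₂ := c.pairHom_vertexHom (m := ⟨2⟩) ![i, j, k] (k := 0) (l := 2) (by decide) x hx
    -- All three gluings are compared through vertex `2` of the triple intersection. Indices may
    -- repeat, so no degeneracy maps are needed.
    refine (cancel_mono ((c.vertexHom (m := ⟨2⟩) ![i, j, k] 2).app ⟨⟨x, hx⟩⟩)).1 ?_
    exact (Category.assoc _ _ _).trans
      ((congrArg (_ ≫ ·) h₁₂).trans (h₀₁.trans h₀₂.symm))
  naturality i j {x y} γ hi hj := by
    let γ' := pathClass (A := cechOpen U ![i, j]) γ fun t => mem_cechOpen_pair (hi t) (hj t)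
    have h₀ := (c.vertexHom (m := ⟨1⟩) ![i, j] 0).naturality γ'
    have h₁ := (c.vertexHom (m := ⟨1⟩) ![i, j] 1).naturality γ'
    exact comp_inv_square h₀ h₁

end PseudoCocone

end

end VanKampen

/-! ### The costack property -/

namespace VanKampen

open Set

/-- Components lie in a groupoid, so essential surjectivity needs only a comparison morphism. -/
theorem PseudoCocone.isIso_hom {J : Type w} [Category.{w'} J] {D : J ⥤ Grpd.{v, u}}
    {S : Grpd.{v, u}} {c c' : PseudoCocone D S} (φ : c ⟶ c') : IsIso φ := by
  have (j : J) : IsIso (φ.app j) := NatIso.isIso_of_isIso_app _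
  let ψ : c' ⟶ c :=
    { app := fun j => inv (φ.app j)
      comm := fun {i j} f x => by
        rw [NatIso.isIso_inv_app, NatIso.isIso_inv_app, IsIso.comp_inv_eq, Category.assoc,
          φ.comm, IsIso.inv_hom_id_assoc] }
  exact ⟨ψ, Hom.ext (funext fun j => IsIso.hom_inv_id (φ.app j)),
    Hom.ext (funext fun j => IsIso.inv_hom_id (φ.app j))⟩

section

variable {X : Type u} [TopologicalSpace X] {ι : Type u} {U : ι → Opens X} {V : Opens X}
  (hU : ⨆ i, U i = V)

/-- The strict cocone `Π₁(V)` under the Čech diagram, as a pseudo-cocone. -/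
noncomputable abbrev cechPseudoCocone : PseudoCocone (cechDiagram U (fundamentalGroupoid X))
    ((fundamentalGroupoid X).obj V) :=
  PseudoCocone.ofCocone (cechCocone U (fundamentalGroupoid X) fun i => (le_iSup U i).trans hU.le)

theorem postcomp_cechPseudoCocone_iso {S : Grpd.{u, u}} (χ : (fundamentalGroupoid X).obj V ⥤ S)
    {m n : CechShape} (f : m ⟶ n) (σ : Fin (m.deg.val + 1) → ι)
    (x : FundamentalGroupoid (cechOpen U σ : Set X)) :
    (((cechPseudoCocone hU).postcomp χ).iso f).hom.app ⟨σ, x⟩ =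
      𝟙 ((((cechPseudoCocone hU).postcomp χ).leg m).obj ⟨σ, x⟩) :=
  (congrArg χ.map (eqToHom_app ((cechCocone U (fundamentalGroupoid X) _).w f) _)).trans
    (χ.map_id _)

namespace PseudoCocone

variable {S : Grpd.{u, u}} (c : PseudoCocone (cechDiagram U (fundamentalGroupoid X)) S)

/-- The functor on `Π₁(V)` glued from a pseudo-cocone. -/
noncomputable def glued : (fundamentalGroupoid X).obj V ⥤ S :=
  c.descentDatum.functor (exists_mem_cechMember hU) isOpen_cechMember

/-- The comparison of the glued functor with a summand of a pseudo-cocone, through a vertex. -/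
noncomputable def gluedHom {m : CechShape} (σ : Fin (m.deg.val + 1) → ι)
    (k : Fin (m.deg.val + 1)) :
    inclusionFunctor ((cechOpen_subset_cechMember σ k).trans (cechMember_subset hU (σ k))) ⋙
      c.glued hU ⟶ c.summand m σ where
  app x := (c.descentDatum.comparison (exists_mem_cechMember hU) isOpen_cechMember
    (cechMember_subset hU) (σ k)).app ((inclusionFunctor (cechOpen_subset_cechMember σ k)).obj x) ≫
      (c.vertexHom σ k).app x
  naturality := by
    rintro x y ⟨γ⟩
    let p := FundamentalGroupoid.fromPath (.mk γ)
    have h₁ := (c.descentDatum.comparison (exists_mem_cechMember hU) isOpen_cechMember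
      (cechMember_subset hU) (σ k)).naturality
        ((inclusionFunctor (cechOpen_subset_cechMember σ k)).map p)
    have h₂ := (c.vertexHom σ k).naturality p
    refine (Category.assoc _ _ _).symm.trans ((congrArg (· ≫ _) h₁).trans ?_)
    refine (Category.assoc _ _ _).trans ((congrArg (_ ≫ ·) h₂).trans ?_)
    exact (Category.assoc _ _ _).symm

theorem gluedHom_eq_of_lt {m : CechShape} (σ : Fin (m.deg.val + 1) → ι)
    {k l : Fin (m.deg.val + 1)} (h : k < l) (x : FundamentalGroupoid (cechOpen U σ : Set X)) :
    (c.gluedHom hU σ k).app x = (c.gluedHom hU σ l).app x := by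
  have h₁ := c.pairHom_vertexHom σ h x.as x.as.2
  have h₂ := c.descentDatum.comparison_app_glue (exists_mem_cechMember hU) isOpen_cechMember
    (cechMember_subset hU) (σ k) (σ l) x.as (mem_cechMember_of_mem x.as.2 k)
    (mem_cechMember_of_mem x.as.2 l)
  refine (congrArg (_ ≫ ·) h₁.symm).trans (Eq.trans ?_ (congrArg (· ≫ _) h₂))
  exact (Category.assoc _ _ _).symm

/-- Needed for compatibility with face maps, which may send vertex `0` to another vertex. -/
theorem gluedHom_eq {m : CechShape} (σ : Fin (m.deg.val + 1) → ι)
    (k l : Fin (m.deg.val + 1)) (x : FundamentalGroupoid (cechOpen U σ : Set X)) :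
    (c.gluedHom hU σ k).app x = (c.gluedHom hU σ l).app x := by
  rcases lt_trichotomy k l with h | rfl | h
  · exact c.gluedHom_eq_of_lt hU σ h x
  · rfl
  · exact (c.gluedHom_eq_of_lt hU σ h x).symm

/-- The comparison of the pseudo-cocone of the glued functor with the given pseudo-cocone. -/
noncomputable def gluedComparison : ((cechPseudoCocone hU).kappa S).obj (c.glued hU) ⟶ c where
  app m :=
    { app := fun z => (c.gluedHom hU z.1 0).app z.2
      naturality := by
        rintro ⟨σ, x⟩ ⟨_, y⟩ ⟨p⟩
        exact (c.gluedHom hU σ 0).naturality p }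
  comm {m n} f z := by
    obtain ⟨σ, x⟩ := z
    refine (congrArg (· ≫ _) (postcomp_cechPseudoCocone_iso hU (c.glued hU) f σ x)).trans ?_
    have h₁ := c.vertexHom_faceHom f σ x.as.1 x.as.2 0
    refine (Category.id_comp _).trans ((c.gluedHom_eq hU σ 0 (CechShape.toFun f 0) x).trans ?_)
    exact (congrArg (_ ≫ ·) h₁.symm).trans (Category.assoc _ _ _).symm

end PseudoCocone

theorem faithful_kappa_cechPseudoCocone (S : Grpd.{u, u}) :
    ((cechPseudoCocone hU).kappa S).Faithful where
  map_injective {χ χ'} τ τ' h := by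
    ext x
    obtain ⟨i, hi⟩ := exists_mem_cechMember hU x.as
    let z : coprod fun σ : Fin 1 → ι => (fundamentalGroupoid X).obj (cechOpen U σ) :=
      ⟨fun _ => i, ⟨⟨x.as.1, hi⟩⟩⟩
    exact congrArg (fun φ => NatTrans.app (PseudoCocone.Hom.app φ (⟨0⟩ : CechShape)) z) h

theorem full_kappa_cechPseudoCocone (S : Grpd.{u, u}) :
    ((cechPseudoCocone hU).kappa S).Full where
  map_surjective {χ χ'} φ := by
    -- The structure isomorphisms on both sides are identities, so `φ` takes equal values on a
    -- summand and on its faces.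
    have face {m n : CechShape} (f : m ⟶ n) (σ : Fin (m.deg.val + 1) → ι)
        (x : FundamentalGroupoid (cechOpen U σ : Set X)) :
        (φ.app m).app ⟨σ, x⟩ =
          (φ.app n).app (((cechDiagram U (fundamentalGroupoid X)).map f).obj ⟨σ, x⟩) := by
      refine (Category.id_comp _).symm.trans (Eq.trans ?_ (Category.comp_id _))
      refine (congrArg (· ≫ _) (postcomp_cechPseudoCocone_iso hU χ f σ x).symm).trans
        ((φ.comm f ⟨σ, x⟩).trans ?_)
      exact congrArg (_ ≫ ·) (postcomp_cechPseudoCocone_iso hU χ' f σ x)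
    -- Both values equal the one on the double intersection, so the component at `x` does not depend
    -- on the member.
    have member (i j : ι) (x : X) (hi : x ∈ cechMember U i) (hj : x ∈ cechMember U j) :
        (φ.app (⟨0⟩ : CechShape)).app ⟨fun _ => i, ⟨⟨x, hi⟩⟩⟩ =
          (φ.app (⟨0⟩ : CechShape)).app ⟨fun _ => j, ⟨⟨x, hj⟩⟩⟩ := by
      exact (face (CechShape.vertex ⟨1⟩ 0) ![i, j] ⟨⟨x, mem_cechOpen_pair hi hj⟩⟩).symm.trans
        (face (CechShape.vertex ⟨1⟩ 1) ![i, j] ⟨⟨x, mem_cechOpen_pair hi hj⟩⟩)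
    have hc := exists_mem_cechMember hU
    let τ (x : FundamentalGroupoid (V : Set X)) : χ.obj x ⟶ χ'.obj x :=
      (φ.app (⟨0⟩ : CechShape)).app ⟨fun _ => (hc x.as).choose, ⟨⟨x.as, (hc x.as).choose_spec⟩⟩⟩
    have hτ (x : FundamentalGroupoid (V : Set X)) (i : ι) (hi : (x.as : X) ∈ cechMember U i) :
        τ x = (φ.app (⟨0⟩ : CechShape)).app ⟨fun _ => i, ⟨⟨x.as, hi⟩⟩⟩ :=
      member _ _ _ _ _
    refine ⟨⟨τ, fun x y p => naturality_of_cover isOpen_cechMember (cechMember_subset hU) hc τ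
      (fun i x y p => ?_) p⟩, ?_⟩
    · rw [hτ ((inclusionFunctor (cechMember_subset hU i)).obj x) i x.as.2,
        hτ ((inclusionFunctor (cechMember_subset hU i)).obj y) i y.as.2]
      exact (φ.app (⟨0⟩ : CechShape)).naturality (X := ⟨fun _ => i, x⟩) (Y := ⟨fun _ => i, y⟩)
        (.mk p)
    · refine PseudoCocone.Hom.ext (funext fun m => NatTrans.ext (funext ?_))
      rintro ⟨σ, x⟩
      exact (hτ _ (σ 0) (mem_cechMember_of_mem x.as.2 0)).trans (face (m.vertex 0) σ x).symm

theorem essSurj_kappa_cechPseudoCocone (S : Grpd.{u, u}) :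
    ((cechPseudoCocone hU).kappa S).EssSurj where
  mem_essImage c := ⟨c.glued hU,
    ⟨@asIso _ _ _ _ (c.gluedComparison hU) (PseudoCocone.isIso_hom _)⟩⟩

theorem isCostack_fundamentalGroupoid : IsCostack (fundamentalGroupoid X) := fun _ _ _ hU S =>
  { faithful := faithful_kappa_cechPseudoCocone hU S
    full := full_kappa_cechPseudoCocone hU S
    essSurj := essSurj_kappa_cechPseudoCocone hU S }

end

end VanKampen

theorem mainTheorem1 (X : Type u) [TopologicalSpace X] :
    VanKampen.IsCosheaf (VanKampen.fundamentalGroupoid X) ∧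
      VanKampen.IsCostack (VanKampen.fundamentalGroupoid X) :=
  ⟨VanKampen.isCosheaf_fundamentalGroupoid, VanKampen.isCostack_fundamentalGroupoid⟩
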